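/- Let $M$ be a smooth $7$-manifold, $J\subset\mathbb R$ an interval, and $\varphi=\varphi(t)$, $t\in J$, a family of $\mathrm G_2$-structures on $M$, i.e. of smooth positive $3$-forms. (Positive means: at each point there is a basis $e^1,\dots,e^7$ of the cotangent space in which $\varphi=e^{123}-e^{167}-e^{527}-e^{563}-e^{415}-e^{426}-e^{437}$.) In local coordinates $x^1,\dots,x^7$, with summation over repeated indices, let $$B_{ij}\,dx^1\wedge\dots\wedge dx^7=(\partial_i\lrcorner\varphi)\wedge(\partial_j\lrcorner\varphi)\wedge\varphi .$$ The metric $g$ and the volume form $\mathsf{vol}$ determined by $\varphi$ are $$g_{ij}=\frac{1}{6^{2/9}}\,\frac{B_{ij}}{\det(B)^{1/9}},\qquad \mathsf{vol}=-\frac{1}{6^{7/9}}\det(B)^{1/9}\,dx^1\wedge\dots\wedge dx^7$$ (real ninth roots), so that $B_{ij}\,dx^1\wedge\dots\wedge dx^7=-6\,g_{ij}\,\mathsf{vol}$, and $\mathsf{vol}=\sqrt{\det g}\,dx^1\wedge\dots\wedge dx^7$ in coordinates which are positively oriented for the orientation determined by $\varphi$. Let $g^{ij}$ be the inverse matrix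 of $g_{ij}$ and $\psi=*\varphi$ the Hodge dual $4$-form with respect to $g$ and $\mathsf{vol}$. Let $h=h(t)$ be symmetric $2$-tensors and $X=X(t)$ vector fields on $M$; put $h^l_i=g^{lm}h_{mi}$, $h^{ij}=g^{ia}g^{jb}h_{ab}$ and $\operatorname{Tr}_g(h)=g^{ij}h_{ij}$. Suppose that $\varphi$ evolves by the general flow $$\frac{\partial}{\partial t}\varphi_{ijk}=h^l_i\varphi_{ljk}+h^l_j\varphi_{ilk}+h^l_k\varphi_{ijl}+X^l\psi_{lijk}.$$ Then, in every local coordinate system and at every $t\in J$, $$\frac{\partial}{\partial t}B_{ij}=\operatorname{Tr}_g(h)\,B_{ij}+h^l_iB_{lj}+h^l_jB_{il};$$ in particular the evolution of $B_{ij}$ does not depend on the vector field $X$. Consequently $$\frac{\partial}{\partial t}g_{ij}=2h_{ij},\qquad \frac{\partial}{\partial t}g^{ij}=-2h^{ij},\qquad \frac{\partial}{\partial t}\mathsf{vol}=\operatorname{Tr}_g(h)\,\mathsf{vol}.$$ -/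

import Mathlib

open scoped Manifold ContDiff

noncomputable section

namespace G2

/-! ### Linear algebra of alternating forms on one tangent space -/

section LinearAlgebra

variable {V : Type*} [AddCommGroup V] [Module ℝ V]

/-- The wedge product of real-valued alternating forms, normalised so that
`(α ∧ β)(v₁, …, v_{k+l})` is the sum over `(k,l)`-shuffles; in particular
`(dx¹ ∧ … ∧ dxⁿ)(∂₁, …, ∂ₙ) = 1`. -/
def wedge {k l : ℕ} (α : V [⋀^Fin k]→ₗ[ℝ] ℝ) (β : V [⋀^Fin l]→ₗ[ℝ] ℝ) :
    V [⋀^Fin (k + l)]→ₗ[ℝ] ℝ :=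
  ((LinearMap.mul' ℝ ℝ).compAlternatingMap (α.domCoprod β)).domDomCongr finSumFinEquiv

/-- The interior product `u ⌟ α`, that is, `(u ⌟ α)(v₁, …, v_k) = α(u, v₁, …, v_k)`. -/
def interior {k : ℕ} (u : V) (α : V [⋀^Fin (k + 1)]→ₗ[ℝ] ℝ) : V [⋀^Fin k]→ₗ[ℝ] ℝ :=
  α.curryLeft u

/-- The value at `v` of the decomposable form `eⁱ ∧ eʲ ∧ eᵏ`, for the basis `(eⁱ)` of `V*` dual to
the basis `b` of `V`. -/
def dualTriple (b : Module.Basis (Fin 7) ℝ V) (i j k : Fin 7) (v : Fin 3 → V) : ℝ :=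
  Matrix.det (Matrix.of fun p q : Fin 3 => b.coord (![i, j, k] p) (v q))

/-- A `3`-form on a `7`-dimensional space is positive if in some basis it is the standard form
`e¹²³ - e¹⁶⁷ - e⁵²⁷ - e⁵⁶³ - e⁴¹⁵ - e⁴²⁶ - e⁴³⁷`
(the basis is numbered `0, …, 6` in the code). -/
def IsPositive (φ : V [⋀^Fin 3]→ₗ[ℝ] ℝ) : Prop :=
  ∃ b : Module.Basis (Fin 7) ℝ V, ∀ v : Fin 3 → V,
    φ v = dualTriple b 0 1 2 v - dualTriple b 0 5 6 v - dualTriple b 4 1 6 v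
      - dualTriple b 4 5 2 v - dualTriple b 3 0 4 v - dualTriple b 3 1 5 v
      - dualTriple b 3 2 6 v

/-- The components `B_ij` of the `Sym² V* ⊗ Λ⁷ V*`-valued tensor of a `3`-form `φ`, defined by
`B_ij e¹ ∧ … ∧ e⁷ = (b_i ⌟ φ) ∧ (b_j ⌟ φ) ∧ φ`. -/
def tensorB (φ : V [⋀^Fin 3]→ₗ[ℝ] ℝ) (b : Module.Basis (Fin 7) ℝ V) :
    Matrix (Fin 7) (Fin 7) ℝ :=
  Matrix.of fun i j => wedge (wedge (interior (b i) φ) (interior (b j) φ)) φ b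

/-- The real ninth root, `root9 (y ^ 9) = y` for all real `y` (also negative ones). -/
def root9 (x : ℝ) : ℝ := (SignType.sign x : ℝ) * |x| ^ ((1 : ℝ) / 9)

/-- The components `g_ij = 6^(-2/9) B_ij / det(B)^(1/9)` of the metric determined by `φ`. -/
def metric (φ : V [⋀^Fin 3]→ₗ[ℝ] ℝ) (b : Module.Basis (Fin 7) ℝ V) :
    Matrix (Fin 7) (Fin 7) ℝ :=
  Matrix.of fun i j =>
    1 / (6 : ℝ) ^ ((2 : ℝ) / 9) * (tensorB φ b i j / root9 (tensorB φ b).det)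

/-- The volume form determined by `φ`: it is `- 6^(-7/9) det(B)^(1/9) e¹ ∧ … ∧ e⁷`. The
coefficient satisfies `B_ij = -6 g_ij vol(b_1, …, b_7)`; it is `√det(g)` if `b` is positively
oriented for the orientation which `φ` determines, and `-√det(g)` otherwise. -/
def volForm (φ : V [⋀^Fin 3]→ₗ[ℝ] ℝ) (b : Module.Basis (Fin 7) ℝ V) : V [⋀^Fin 7]→ₗ[ℝ] ℝ :=
  (-(1 / (6 : ℝ) ^ ((7 : ℝ) / 9)) * root9 (tensorB φ b).det) • b.det

/-- The components `g^ij` of the inverse metric. -/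
def metricInv (φ : V [⋀^Fin 3]→ₗ[ℝ] ℝ) (b : Module.Basis (Fin 7) ℝ V) :
    Matrix (Fin 7) (Fin 7) ℝ :=
  (metric φ b)⁻¹

/-- The dual `4`-form `ψ = ∗φ`. The Hodge star is given by the usual formula
`(∗φ)_{ijkl} = (1/3!) φ_{pqr} g^{pa} g^{qb} g^{rc} vol_{abcijkl}`, which is the one satisfying
`α ∧ ∗φ = g(α, φ) vol` for all `3`-forms `α`. -/
def dualForm (φ : V [⋀^Fin 3]→ₗ[ℝ] ℝ) (b : Module.Basis (Fin 7) ℝ V) : V [⋀^Fin 4]→ₗ[ℝ] ℝ :=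
  (1 / 6 : ℝ) • ∑ a, ∑ c, ∑ d,
    (∑ p, ∑ q, ∑ r, φ ![b p, b q, b r] *
        (metricInv φ b p a * metricInv φ b q c * metricInv φ b r d)) •
      interior (b d) (interior (b c) (interior (b a) (volForm φ b)))

/-- The components `h_ij` of a `2`-tensor. -/
def tensorComp (h : LinearMap.BilinForm ℝ V) (b : Module.Basis (Fin 7) ℝ V) :
    Matrix (Fin 7) (Fin 7) ℝ :=
  Matrix.of fun i j => h (b i) (b j)

/-- `raiseOne φ h b l i` is `h^l_i = g^{lm} h_{mi}`, for the metric `g` of `φ`. -/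
def raiseOne (φ : V [⋀^Fin 3]→ₗ[ℝ] ℝ) (h : LinearMap.BilinForm ℝ V)
    (b : Module.Basis (Fin 7) ℝ V) (l i : Fin 7) : ℝ :=
  ∑ m, metricInv φ b l m * tensorComp h b m i

/-- `raiseTwo φ h b i j` is `h^{ij} = g^{ip} g^{jq} h_{pq}`, for the metric `g` of `φ`. -/
def raiseTwo (φ : V [⋀^Fin 3]→ₗ[ℝ] ℝ) (h : LinearMap.BilinForm ℝ V)
    (b : Module.Basis (Fin 7) ℝ V) (i j : Fin 7) : ℝ :=
  ∑ p, ∑ q, metricInv φ b i p * metricInv φ b j q * tensorComp h b p q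

/-- `Tr_g(h) = g^{ij} h_{ij}`, for the metric `g` of `φ`. -/
def traceG (φ : V [⋀^Fin 3]→ₗ[ℝ] ℝ) (h : LinearMap.BilinForm ℝ V)
    (b : Module.Basis (Fin 7) ℝ V) : ℝ :=
  ∑ i, ∑ j, metricInv φ b i j * tensorComp h b i j

/-- The right hand side of the general flow equation:
`h^l_i φ_ljk + h^l_j φ_ilk + h^l_k φ_ijl + X^l ψ_lijk`. -/
def flowRHS (φ : V [⋀^Fin 3]→ₗ[ℝ] ℝ) (h : LinearMap.BilinForm ℝ V) (X : V)
    (b : Module.Basis (Fin 7) ℝ V) (i j k : Fin 7) : ℝ :=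
  ∑ l, (raiseOne φ h b l i * φ ![b l, b j, b k] + raiseOne φ h b l j * φ ![b i, b l, b k]
    + raiseOne φ h b l k * φ ![b i, b j, b l]
    + b.repr X l * dualForm φ b ![b l, b i, b j, b k])

end LinearAlgebra

/-! ### `G₂`-structures on a `7`-manifold -/

section Manifold

variable {M : Type*} [TopologicalSpace M] [ChartedSpace (EuclideanSpace ℝ (Fin 7)) M]

/-- A smooth local coordinate system is a diffeomorphism. -/
theorem mdifferentiable_chart {e : OpenPartialHomeomorph M (EuclideanSpace ℝ (Fin 7))}
    (he : e ∈ IsManifold.maximalAtlas (𝓡 7) ∞ M) : e.MDifferentiable (𝓡 7) (𝓡 7) :=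
  ⟨(contMDiffOn_of_mem_maximalAtlas he).mdifferentiableOn (by simp),
    (contMDiffOn_symm_of_mem_maximalAtlas he).mdifferentiableOn (by simp)⟩

variable [IsManifold (𝓡 7) ∞ M]

/-- A `G₂`-structure on a smooth `7`-manifold: a smooth `3`-form which is positive at each point. -/
structure G2Structure (M : Type*) [TopologicalSpace M]
    [ChartedSpace (EuclideanSpace ℝ (Fin 7)) M] [IsManifold (𝓡 7) ∞ M] where
  /-- the underlying `3`-form -/
  toForm : ∀ x : M, TangentSpace (𝓡 7) x [⋀^Fin 3]→L[ℝ] ℝ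
  smooth : ContMDiff (𝓡 7) ((𝓡 7).prod 𝓘(ℝ, EuclideanSpace ℝ (Fin 7) [⋀^Fin 3]→L[ℝ] ℝ)) ∞
    (fun x : M => Bundle.TotalSpace.mk' (EuclideanSpace ℝ (Fin 7) [⋀^Fin 3]→L[ℝ] ℝ)
      (E := fun x : M => TangentSpace (𝓡 7) x [⋀^Fin 3]→L[ℝ] Bundle.Trivial M ℝ x) x (toForm x))
  positive : ∀ x : M, IsPositive (toForm x).toAlternatingMap

/-- The value at `x` of a `G₂`-structure, as an algebraic alternating form. -/
def G2Structure.at (φ : G2Structure M) (x : M) : TangentSpace (𝓡 7) x [⋀^Fin 3]→ₗ[ℝ] ℝ :=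
  (φ.toForm x).toAlternatingMap

/-- The coordinate frame `∂/∂x¹, …, ∂/∂x⁷` at `x` of the local coordinate system `e`: the basis
of the tangent space which the differential of `e` sends to the standard basis of `ℝ⁷`. -/
def coordFrame {e : OpenPartialHomeomorph M (EuclideanSpace ℝ (Fin 7))}
    (he : e ∈ IsManifold.maximalAtlas (𝓡 7) ∞ M) {x : M} (hx : x ∈ e.source) :
    Module.Basis (Fin 7) ℝ (TangentSpace (𝓡 7) x) :=
  (EuclideanSpace.basisFun (Fin 7) ℝ).toBasis.map
    ((mdifferentiable_chart he).mfderiv hx).symm.toLinearEquiv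

/-- The family `φ t`, `t ∈ J`, of `G₂`-structures evolves by the general flow equation
`∂_t φ_ijk = h^l_i φ_ljk + h^l_j φ_ilk + h^l_k φ_ijl + X^l ψ_lijk`
on the domain of the local coordinate system `e`. -/
def IsGeneralFlow {e : OpenPartialHomeomorph M (EuclideanSpace ℝ (Fin 7))}
    (he : e ∈ IsManifold.maximalAtlas (𝓡 7) ∞ M) (J : Set ℝ) (φ : ℝ → G2Structure M)
    (h : ℝ → ∀ x : M, LinearMap.BilinForm ℝ (TangentSpace (𝓡 7) x))
    (X : ℝ → ∀ x : M, TangentSpace (𝓡 7) x) : Prop :=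
  ∀ (x : M) (hx : x ∈ e.source), ∀ t ∈ J, ∀ i j k : Fin 7,
    HasDerivWithinAt
      (fun s => (φ s).at x ![coordFrame he hx i, coordFrame he hx j, coordFrame he hx k])
      (flowRHS ((φ t).at x) (h t x) (X t x) (coordFrame he hx) i j k) J t

end Manifold

end G2

end

/-!
Contraction and wedge product are natural, so when a `3`-form moves with velocity given by the
derivation action of an endomorphism `A`, the tensor `B` moves with velocity
`tr(A) B + B(A ·, ·) + B(·, A ·)`; the trace comes from the action of `A` on `7`-forms. Raising an
index turns `h` into the endomorphism `H = g⁻¹ h`, whose action on `φ` is the `h`-part of the flow.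
In a basis in which `φ` is standard, `X ⌟ ψ` is the action of `-1/3` times the cross product
`X × ·`, which is skew for `g`, hence traceless and skew for `B`: so `X` drops out. Since `B` has
size `7`, Jacobi's formula gives `det B` the logarithmic derivative `9 tr(H)`, so its ninth root has
logarithmic derivative `tr(H)`, and the evolution of `g`, `g⁻¹` and the volume form follows by
calculus.
-/

noncomputable section

open scoped Matrix

namespace G2

/-! ### Ninth roots, determinants and inverses -/

section Calculus

theorem root9_pow_nine (y : ℝ) : root9 (y ^ 9) = y := by
  have h : |y ^ 9| ^ ((1 : ℝ) / 9) = |y| := by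
    rw [abs_pow, ← Real.rpow_natCast, ← Real.rpow_mul (abs_nonneg y)]
    norm_num
  rw [root9, h, sign_pow]
  rcases lt_trichotomy y 0 with hy | rfl | hy
  · simp [sign_neg hy, abs_of_neg hy, Odd.neg_one_pow (by decide : Odd 9)]
  · simp
  · simp [sign_pos hy, abs_of_pos hy]

theorem root9_eq_mul_rpow (y : ℝ) : root9 y = y * (y ^ 2) ^ (-(4 : ℝ) / 9) := by
  rcases eq_or_ne y 0 with rfl | hy
  · simp [root9]
  have hpos : 0 < |y| := abs_pos.2 hy
  calc root9 y = SignType.sign y * (|y| * |y| ^ (-(8 : ℝ) / 9)) := by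
        rw [root9, ← Real.rpow_one_add' hpos.le (by norm_num)]; norm_num
    _ = y * (y ^ 2) ^ (-(4 : ℝ) / 9) := by
        rw [← mul_assoc, sign_mul_abs, ← sq_abs, ← Real.rpow_natCast, ← Real.rpow_mul hpos.le]
        norm_num

theorem root9_ne_zero {y : ℝ} (hy : y ≠ 0) : root9 y ≠ 0 := by
  rw [root9_eq_mul_rpow]
  positivity

theorem hasDerivAt_root9 {y : ℝ} (hy : y ≠ 0) : HasDerivAt root9 (root9 y / (9 * y)) y := by
  have hsq : HasDerivAt (fun x : ℝ => x ^ 2) (2 * y) y := by simpa using hasDerivAt_pow 2 y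
  have hprod := (hasDerivAt_id' y).mul (hsq.rpow_const (p := -(4 : ℝ) / 9) (.inl (by positivity)))
  rw [funext root9_eq_mul_rpow]
  refine hprod.congr_deriv ?_
  rw [Real.rpow_sub_one (by positivity)]
  field_simp
  ring

variable {ι : Type*} [Fintype ι] [DecidableEq ι] {A : ℝ → Matrix ι ι ℝ} {A' : Matrix ι ι ℝ}
  {J : Set ℝ} {t : ℝ}

theorem hasDerivWithinAt_det (hA : ∀ i j, HasDerivWithinAt (fun s => A s i j) (A' i j) J t) :
    HasDerivWithinAt (fun s => (A s).det) (((A t).adjugate * A').trace) J t := by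
  have hprod (σ : Equiv.Perm ι) := HasDerivWithinAt.fun_finsetProd (u := Finset.univ)
    fun i _ => hA (σ i) i
  have hsum := HasDerivWithinAt.fun_sum (u := Finset.univ)
    fun (σ : Equiv.Perm ι) _ => (hprod σ).const_mul ((σ.sign : ℤ) : ℝ)
  simp only [Matrix.det_apply']
  refine hsum.congr_deriv ?_
  have hcol (i : ι) : ((A t).adjugate * A') i i = ((A t).updateCol i fun k => A' k i).det := by
    rw [← Matrix.cramer_apply, Matrix.cramer_eq_adjugate_mulVec]; rfl
  simp only [Matrix.trace, Matrix.diag, hcol, Matrix.det_apply', Finset.mul_sum]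
  rw [Finset.sum_comm]
  refine Finset.sum_congr rfl fun i _ => Finset.sum_congr rfl fun σ _ => ?_
  rw [← Finset.prod_erase_mul _ _ (Finset.mem_univ i), Matrix.updateCol_self, smul_eq_mul]
  congr 2
  exact Finset.prod_congr rfl fun j hj => (Matrix.updateCol_ne (Finset.ne_of_mem_erase hj)).symm

theorem hasDerivWithinAt_inv_apply
    (hA : ∀ i j, HasDerivWithinAt (fun s => A s i j) (A' i j) J t) (h0 : (A t).det ≠ 0) (i j : ι) :
    HasDerivWithinAt (fun s => (A s)⁻¹ i j) (-((A t)⁻¹ * A' * (A t)⁻¹) i j) J t := by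
  let _ : NormedRing (Matrix ι ι ℝ) := Matrix.linftyOpNormedRing
  let _ : NormedAlgebra ℝ (Matrix ι ι ℝ) := Matrix.linftyOpNormedAlgebra
  have hcurve : HasDerivWithinAt A A' J t :=
    hasDerivWithinAt_pi.2 fun i => hasDerivWithinAt_pi.2 (hA i)
  let u : (Matrix ι ι ℝ)ˣ := Matrix.nonsingInvUnit (A t) (isUnit_iff_ne_zero.2 h0)
  have hinverse := (hasFDerivAt_ringInverse (𝕜 := ℝ) u).comp_hasDerivWithinAt t hcurve
  have hinv : HasDerivWithinAt (fun s => (A s)⁻¹) (-((A t)⁻¹ * A' * (A t)⁻¹)) J t := by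
    have hfun : (fun s => (A s)⁻¹) = Ring.inverse ∘ A :=
      funext fun s => Matrix.nonsing_inv_eq_ringInverse (A s)
    rw [hfun]
    exact hinverse
  exact hasDerivWithinAt_pi.1 (hasDerivWithinAt_pi.1 hinv i) j

end Calculus

/-! ### Forms and the action of endomorphisms -/

variable {V : Type*} [AddCommGroup V] [Module ℝ V]

section Forms

variable {k l : ℕ}

theorem comp_eq_vecCons {α β : Type*} (f : α → β) (x : Fin 3 → α) :
    f ∘ x = ![f (x 0), f (x 1), f (x 2)] := by
  ext p
  fin_cases p <;> rfl

theorem sum_form_apply {ι κ : Type*} (s : Finset κ) (f : κ → V [⋀^ι]→ₗ[ℝ] ℝ) (v : ι → V) :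
    (∑ x ∈ s, f x) v = ∑ x ∈ s, f x v :=
  map_sum (AddMonoidHom.mk' (fun η : V [⋀^ι]→ₗ[ℝ] ℝ => η v) fun _ _ => rfl) f s

theorem interior_apply (u : V) (α : V [⋀^Fin (k + 1)]→ₗ[ℝ] ℝ) (v : Fin k → V) :
    interior u α v = α (Matrix.vecCons u v) :=
  rfl

/-- The wedge product as a bilinear map. -/
def wedgeHom (k l : ℕ) :
    (V [⋀^Fin k]→ₗ[ℝ] ℝ) →ₗ[ℝ] (V [⋀^Fin l]→ₗ[ℝ] ℝ) →ₗ[ℝ] V [⋀^Fin (k + l)]→ₗ[ℝ] ℝ :=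
  (TensorProduct.mk ℝ _ _).compr₂ <|
    (AlternatingMap.domDomCongrₗ ℝ finSumFinEquiv).toLinearMap ∘ₗ
      LinearMap.compAlternatingMapₗ ℝ (LinearMap.mul' ℝ ℝ) ∘ₗ AlternatingMap.domCoprod'

theorem wedgeHom_apply (α : V [⋀^Fin k]→ₗ[ℝ] ℝ) (β : V [⋀^Fin l]→ₗ[ℝ] ℝ) :
    wedgeHom k l α β = wedge α β :=
  rfl

theorem wedge_apply (α : V [⋀^Fin k]→ₗ[ℝ] ℝ) (β : V [⋀^Fin l]→ₗ[ℝ] ℝ) (v : Fin (k + l) → V) :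
    wedge α β v = ((k.factorial * l.factorial : ℕ) : ℝ)⁻¹ *
      ∑ σ : Equiv.Perm (Fin k ⊕ Fin l), ((σ.sign : ℤ) : ℝ) *
        (α (fun p => v (finSumFinEquiv (σ (Sum.inl p)))) *
          β (fun p => v (finSumFinEquiv (σ (Sum.inr p))))) := by
  have h := congrArg (fun η => LinearMap.mul' ℝ ℝ (η (fun p => v (finSumFinEquiv p))))
    (MultilinearMap.domCoprod_alternization_eq α β)
  have h0 : ((k.factorial * l.factorial : ℕ) : ℝ) ≠ 0 :=
    Nat.cast_ne_zero.mpr (Nat.mul_ne_zero k.factorial_ne_zero l.factorial_ne_zero)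
  rw [eq_inv_mul_iff_mul_eq₀ h0]
  simp only [Fintype.card_fin] at h
  refine Eq.trans (Eq.trans ?_ h.symm) ?_
  · exact ((map_nsmul (LinearMap.mul' ℝ ℝ) _ _).trans (nsmul_eq_mul _ _)).symm
  simp only [MultilinearMap.alternatization_apply, map_sum]
  refine Finset.sum_congr rfl fun σ _ => ?_
  rw [Units.smul_def, map_zsmul, zsmul_eq_mul]
  simp

end Forms

section EndAction

variable {ι : Type*} [DecidableEq ι] {k l : ℕ}

theorem update_id_apply_eq_update (A : Module.End ℝ V) (p : ι) (v : ι → V) :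
    (fun i => (Function.update (fun _ => LinearMap.id) p A i : Module.End ℝ V) (v i)) =
      Function.update v p (A (v p)) := by
  ext i
  rcases eq_or_ne i p with rfl | hi <;> simp [*]

theorem sum_repr_mul_map_update {κ : Type*} [Fintype κ] (η : V [⋀^ι]→ₗ[ℝ] ℝ)
    (b : Module.Basis κ ℝ V) (v : ι → V) (p : ι) (w : V) :
    ∑ l, b.repr w l * η (Function.update v p (b l)) = η (Function.update v p w) := by
  conv_rhs => rw [← b.sum_repr w, η.map_update_sum]
  simp only [η.map_update_smul, smul_eq_mul]

theorem map_update_basis [Finite ι] (η : V [⋀^ι]→ₗ[ℝ] ℝ) (b : Module.Basis ι ℝ V) (p : ι) (w : V) :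
    η (Function.update b p w) = b.repr w p * η b := by
  have := Fintype.ofFinite ι
  rw [← sum_repr_mul_map_update η b, Finset.sum_eq_single p, Function.update_eq_self]
  · exact fun q _ hq => by rw [η.map_update_self _ hq.symm, mul_zero]
  · exact fun hp => absurd (Finset.mem_univ p) hp

variable [Fintype ι]

theorem sum_map_update_eq_zero (φ : V [⋀^ι]→ₗ[ℝ] ℝ) (A : Module.End ℝ V) {v : ι → V} {i j : ι}
    (hv : v i = v j) (hij : i ≠ j) : ∑ p, φ (Function.update v p (A (v p))) = 0 := by
  have hother (p : ι) (hp : p ≠ i ∧ p ≠ j) : φ (Function.update v p (A (v p))) = 0 :=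
    φ.map_eq_zero_of_eq _ (by simp [hp.1.symm, hp.2.symm, hv]) hij
  rw [Fintype.sum_eq_add i j hij hother]
  have hswap : Function.update v j (A (v j)) = Function.update v i (A (v i)) ∘ Equiv.swap i j := by
    rw [Function.update_comp_equiv, Equiv.comp_swap_eq_update, Equiv.symm_swap,
      Equiv.swap_apply_left, hv]
    rw [← hv, Function.update_comm hij.symm, Function.update_eq_self, Function.update_idem]
  rw [hswap, φ.map_add_swap _ hij]

/-- The derivation of the algebra of alternating forms induced by an endomorphism `A` of `V`, that
is, the derivative at `0` of the pullbacks by `1 + r A`. -/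
def endAction (φ : V [⋀^ι]→ₗ[ℝ] ℝ) : Module.End ℝ V →ₗ[ℝ] V [⋀^ι]→ₗ[ℝ] ℝ where
  toFun A :=
    { ∑ p, φ.toMultilinearMap.compLinearMap (Function.update (fun _ => LinearMap.id) p A) with
      map_eq_zero_of_eq' v i j hv hij := by
        simpa [update_id_apply_eq_update] using sum_map_update_eq_zero φ A hv hij }
  map_add' A B := by
    ext v
    simp [update_id_apply_eq_update, Finset.sum_add_distrib]
  map_smul' c A := by
    ext v
    simp [update_id_apply_eq_update, Finset.mul_sum]

theorem endAction_apply (φ : V [⋀^ι]→ₗ[ℝ] ℝ) (A : Module.End ℝ V) (v : ι → V) :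
    endAction φ A v = ∑ p, φ (Function.update v p (A (v p))) := by
  simp [endAction, update_id_apply_eq_update]

theorem endAction_interior (u : V) (φ : V [⋀^Fin (k + 1)]→ₗ[ℝ] ℝ) (A : Module.End ℝ V) :
    interior u (endAction φ A) = endAction (interior u φ) A + interior (A u) φ := by
  ext v
  simp only [interior_apply, AlternatingMap.add_apply, endAction_apply, Fin.sum_univ_succ,
    Matrix.vecCons, Fin.update_cons_zero, Fin.cons_zero, Fin.cons_succ, Fin.cons_update]
  exact add_comm _ _

theorem endAction_wedge (α : V [⋀^Fin k]→ₗ[ℝ] ℝ) (β : V [⋀^Fin l]→ₗ[ℝ] ℝ) (A : Module.End ℝ V) :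
    endAction (wedge α β) A = wedge (endAction α A) β + wedge α (endAction β A) := by
  ext v
  simp only [endAction_apply, AlternatingMap.add_apply, wedge_apply, ← Finset.mul_sum, ← mul_add]
  rw [Finset.sum_comm, ← Finset.sum_add_distrib]
  refine congrArg _ (Finset.sum_congr rfl fun σ _ => ?_)
  let f : Fin k ⊕ Fin l ≃ Fin (k + l) := σ.trans finSumFinEquiv
  have hl (q : Fin k) (w : V) : (fun p => Function.update v (f (.inl q)) w (f (.inl p))) =
      Function.update (fun p => v (f (.inl p))) q w :=
    Function.update_comp_eq_of_injective v (f.injective.comp Sum.inl_injective) q w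
  have hr (q : Fin l) (w : V) : (fun p => Function.update v (f (.inr q)) w (f (.inr p))) =
      Function.update (fun p => v (f (.inr p))) q w :=
    Function.update_comp_eq_of_injective v (f.injective.comp Sum.inr_injective) q w
  have hlr (q : Fin l) (w : V) : (fun p => Function.update v (f (.inr q)) w (f (.inl p))) =
      fun p => v (f (.inl p)) :=
    Function.update_comp_eq_of_forall_ne v w fun p => f.injective.ne Sum.inl_ne_inr
  have hrl (q : Fin k) (w : V) : (fun p => Function.update v (f (.inl q)) w (f (.inr p))) =
      fun p => v (f (.inr p)) :=
    Function.update_comp_eq_of_forall_ne v w fun p => f.injective.ne Sum.inr_ne_inl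
  rw [← f.sum_comp, Fintype.sum_sum_type]
  refine (congrArg₂ (· + ·)
    (Finset.sum_congr rfl fun q _ => congrArg₂ (fun x y => _ * (α x * β y)) (hl q _) (hrl q _))
    (Finset.sum_congr rfl fun q _ =>
      congrArg₂ (fun x y => _ * (α x * β y)) (hlr q _) (hr q _))).trans ?_
  simp only [Finset.sum_mul, Finset.mul_sum]
  rfl

theorem endAction_top (η : V [⋀^ι]→ₗ[ℝ] ℝ) (b : Module.Basis ι ℝ V) (A : Module.End ℝ V) :
    endAction η A = LinearMap.trace ℝ V A • η := by
  have hb : endAction η A b = LinearMap.trace ℝ V A * η b := by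
    simp only [endAction_apply, map_update_basis, ← Finset.sum_mul]
    rw [LinearMap.trace_eq_matrix_trace ℝ b]
    simp [Matrix.trace, LinearMap.toMatrix_apply]
  rw [(endAction η A).eq_smul_basis_det b, hb, mul_smul, ← η.eq_smul_basis_det b]

end EndAction

/-! ### Curves of forms and the tensor `B` -/

section Derivatives

variable {k l : ℕ} {J : Set ℝ} {t : ℝ}

theorem sum_prod_repr_mul_map {ι κ : Type*} [Fintype ι] [Fintype κ] [DecidableEq ι]
    (b : Module.Basis κ ℝ V) (f : MultilinearMap ℝ (fun _ : ι => V) ℝ) (v : ι → V) :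
    ∑ x : ι → κ, (∏ p, b.repr (v p) (x p)) * f (b ∘ x) = f v := by
  conv_rhs => rw [← funext fun p => b.sum_repr (v p), f.map_sum]
  exact Finset.sum_congr rfl fun x _ => (f.map_smul_univ _ _).symm

/-- The curve `α` of alternating forms has velocity `α'` at time `t` within `J`, where alternating
forms carry the topology of pointwise convergence. -/
def HasFormDerivWithinAt (α : ℝ → V [⋀^Fin k]→ₗ[ℝ] ℝ) (α' : V [⋀^Fin k]→ₗ[ℝ] ℝ) (J : Set ℝ)
    (t : ℝ) : Prop :=
  ∀ v, HasDerivWithinAt (fun s => α s v) (α' v) J t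

theorem HasFormDerivWithinAt.of_basis {κ : Type*} [Finite κ] (b : Module.Basis κ ℝ V)
    {α : ℝ → V [⋀^Fin k]→ₗ[ℝ] ℝ} {α' : V [⋀^Fin k]→ₗ[ℝ] ℝ}
    (h : ∀ x : Fin k → κ, HasDerivWithinAt (fun s => α s (b ∘ x)) (α' (b ∘ x)) J t) :
    HasFormDerivWithinAt α α' J t := fun v => by
  have := Fintype.ofFinite κ
  have hexpand (η : V [⋀^Fin k]→ₗ[ℝ] ℝ) := sum_prod_repr_mul_map b η.toMultilinearMap v
  simp only [AlternatingMap.coe_multilinearMap] at hexpand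
  simp only [← hexpand]
  exact HasDerivWithinAt.fun_sum fun x _ => (h x).const_mul _

theorem HasFormDerivWithinAt.interior {α : ℝ → V [⋀^Fin (k + 1)]→ₗ[ℝ] ℝ}
    {α' : V [⋀^Fin (k + 1)]→ₗ[ℝ] ℝ} (h : HasFormDerivWithinAt α α' J t) (u : V) :
    HasFormDerivWithinAt (fun s => interior u (α s)) (interior u α') J t :=
  fun v => h (Matrix.vecCons u v)

theorem HasFormDerivWithinAt.wedge {α : ℝ → V [⋀^Fin k]→ₗ[ℝ] ℝ} {α' : V [⋀^Fin k]→ₗ[ℝ] ℝ}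
    {β : ℝ → V [⋀^Fin l]→ₗ[ℝ] ℝ} {β' : V [⋀^Fin l]→ₗ[ℝ] ℝ}
    (hα : HasFormDerivWithinAt α α' J t) (hβ : HasFormDerivWithinAt β β' J t) :
    HasFormDerivWithinAt (fun s => wedge (α s) (β s)) (wedge α' (β t) + wedge (α t) β') J t := by
  intro v
  simp only [AlternatingMap.add_apply, wedge_apply, ← mul_add, ← Finset.sum_add_distrib]
  exact (HasDerivWithinAt.fun_sum fun σ _ => ((hα _).mul (hβ _)).const_mul _).const_mul _

end Derivatives

section Bryant

variable {k : ℕ}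

/-- The bilinear map `(u, w) ↦ (u ⌟ φ) ∧ (w ⌟ φ) ∧ φ`. For a `3`-form on a `7`-dimensional space its
components in a frame are the `B_ij`. -/
def bryantForm (φ : V [⋀^Fin (k + 1)]→ₗ[ℝ] ℝ) :
    V →ₗ[ℝ] V →ₗ[ℝ] V [⋀^Fin (k + k + (k + 1))]→ₗ[ℝ] ℝ :=
  ((wedgeHom k k).compl₁₂ φ.curryLeft φ.curryLeft).compr₂ ((wedgeHom (k + k) (k + 1)).flip φ)

theorem bryantForm_apply (φ : V [⋀^Fin (k + 1)]→ₗ[ℝ] ℝ) (u w : V) :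
    bryantForm φ u w = wedge (wedge (interior u φ) (interior w φ)) φ :=
  rfl

theorem hasFormDerivWithinAt_bryantForm {φ : ℝ → V [⋀^Fin (k + 1)]→ₗ[ℝ] ℝ} {A : Module.End ℝ V}
    {J : Set ℝ} {t : ℝ} (b : Module.Basis (Fin (k + k + (k + 1))) ℝ V)
    (hφ : HasFormDerivWithinAt φ (endAction (φ t) A) J t) (u w : V) :
    HasFormDerivWithinAt (fun s => bryantForm (φ s) u w)
      (LinearMap.trace ℝ V A • bryantForm (φ t) u w + bryantForm (φ t) (A u) w +
        bryantForm (φ t) u (A w)) J t := by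
  have hvelocity : LinearMap.trace ℝ V A • bryantForm (φ t) u w + bryantForm (φ t) (A u) w +
      bryantForm (φ t) u (A w) =
      wedge (wedge (interior u (endAction (φ t) A)) (interior w (φ t)) +
          wedge (interior u (φ t)) (interior w (endAction (φ t) A))) (φ t) +
        wedge (wedge (interior u (φ t)) (interior w (φ t))) (endAction (φ t) A) := by
    rw [← endAction_top _ b A]
    simp only [bryantForm_apply, endAction_wedge, endAction_interior]
    simp only [← wedgeHom_apply, map_add, LinearMap.add_apply]
    abel
  rw [hvelocity]
  exact ((hφ.interior u).wedge (hφ.interior w)).wedge hφ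

theorem bryantForm_eq_smul_det (φ : V [⋀^Fin (k + 1)]→ₗ[ℝ] ℝ)
    (b : Module.Basis (Fin (k + k + (k + 1))) ℝ V) (u w : V) :
    bryantForm φ u w =
      (∑ i, ∑ j, b.repr u i * (b.repr w j * bryantForm φ (b i) (b j) b)) • b.det := by
  simp only [Finset.sum_smul, mul_smul, ← (bryantForm φ _ _).eq_smul_basis_det b]
  conv_lhs => rw [← b.sum_repr u, ← b.sum_repr w]
  simp only [map_sum, map_smul, LinearMap.sum_apply, LinearMap.smul_apply, Finset.smul_sum]
  rw [Finset.sum_comm]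
  exact Finset.sum_congr rfl fun i _ => Finset.sum_congr rfl fun j _ => smul_comm _ _ _

theorem bryantForm_apply_of_diagonal (φ : V [⋀^Fin (k + 1)]→ₗ[ℝ] ℝ)
    (b : Module.Basis (Fin (k + k + (k + 1))) ℝ V) {r : ℝ}
    (hr : ∀ i j, bryantForm φ (b i) (b j) b = if i = j then r else 0) (u w : V)
    (v : Fin (k + k + (k + 1)) → V) :
    bryantForm φ u w v = r * (∑ i, b.repr u i * b.repr w i) * b.det v := by
  rw [bryantForm_eq_smul_det φ b u w]
  simp only [hr, mul_ite, mul_zero, Finset.sum_ite_eq, Finset.mem_univ, if_true, Finset.mul_sum,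
    AlternatingMap.smul_apply, smul_eq_mul]
  exact congrArg (· * _) (Finset.sum_congr rfl fun i _ => by ring)

theorem tensorB_apply (φ : V [⋀^Fin 3]→ₗ[ℝ] ℝ) (b : Module.Basis (Fin 7) ℝ V) (i j : Fin 7) :
    tensorB φ b i j = bryantForm φ (b i) (b j) b := by
  rw [bryantForm_apply, tensorB, Matrix.of_apply]

end Bryant

/-! ### The standard positive form -/

section LeviCivita

variable {m n : ℕ}

/-- The factor which the pair of positions with entries `a`, `c` contributes to the sign of a
permutation. -/
def inversionSign (a c : Fin n) : ℤ :=
  if a < c then 1 else if c < a then -1 else 0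

/-- The Levi-Civita symbol: the sign of the permutation which a list enumerates, and `0` if the list
has a repeated entry. It is defined on lists so that the kernel evaluates it quickly. -/
def leviCivita : List (Fin n) → ℤ
  | [] => 1
  | a :: l => (l.map (inversionSign a)).prod * leviCivita l

theorem leviCivita_ofFn (x : Fin m → Fin n) :
    leviCivita (List.ofFn x) = ∏ i, ∏ j ∈ Finset.Ioi i, inversionSign (x i) (x j) := by
  induction m with
  | zero => simp [leviCivita]
  | succ m ih =>
    rw [List.ofFn_succ, leviCivita, ih, Fin.prod_univ_succ, Fin.prod_Ioi_zero]
    simp only [Fin.prod_Ioi_succ, List.map_ofFn, List.prod_ofFn, Function.comp_apply]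

theorem leviCivita_ofFn_perm (σ : Equiv.Perm (Fin n)) : leviCivita (List.ofFn σ) = σ.sign := by
  rw [leviCivita_ofFn, σ.prod_Ioi_comp_eq_sign_mul_prod (f := inversionSign)]
  · have hpos : ∏ i : Fin n, ∏ j ∈ Finset.Ioi i, inversionSign i j = 1 :=
      Finset.prod_eq_one fun i _ => Finset.prod_eq_one fun j hj => if_pos (Finset.mem_Ioi.1 hj)
    rw [hpos, mul_one, Int.cast_id]
  · intro i j
    rcases lt_trichotomy i j with h | rfl | h
    · simp [inversionSign, h, h.not_gt]
    · simp [inversionSign]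
    · simp [inversionSign, h, h.not_gt]

theorem leviCivita_ofFn_eq_zero {x : Fin m → Fin n} (hx : ¬ x.Injective) :
    leviCivita (List.ofFn x) = 0 := by
  rw [leviCivita_ofFn]
  obtain ⟨i, j, hij, hne⟩ := Function.not_injective_iff.1 hx
  wlog hlt : i < j generalizing i j
  · exact this j i hij.symm hne.symm (lt_of_le_of_ne (not_lt.1 hlt) hne.symm)
  exact Finset.prod_eq_zero (Finset.mem_univ i) <|
    Finset.prod_eq_zero (Finset.mem_Ioi.2 hlt) (by simp [inversionSign, hij])

theorem map_comp_eq_leviCivita_mul (η : V [⋀^Fin n]→ₗ[ℝ] ℝ) (v : Fin n → V) (x : Fin n → Fin n) :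
    η (v ∘ x) = leviCivita (List.ofFn x) * η v := by
  by_cases hx : x.Injective
  · obtain ⟨σ, rfl⟩ : ∃ σ : Equiv.Perm (Fin n), x = σ :=
      ⟨Equiv.ofBijective x (Finite.injective_iff_bijective.1 hx), rfl⟩
    rw [leviCivita_ofFn_perm, η.map_perm, Units.smul_def, zsmul_eq_mul]
  · rw [leviCivita_ofFn_eq_zero hx, Int.cast_zero, zero_mul]
    obtain ⟨i, j, hij, hne⟩ := Function.not_injective_iff.1 hx
    exact η.map_eq_zero_of_eq _ (congrArg v hij) hne

end LeviCivita

section WedgeProd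

variable {k l n : ℕ}

/-- The decomposable form `f₁ ∧ … ∧ f_k`. -/
def wedgeProd (f : Fin k → Module.Dual ℝ V) : V [⋀^Fin k]→ₗ[ℝ] ℝ :=
  MultilinearMap.alternatization ((MultilinearMap.mkPiAlgebra ℝ (Fin k) ℝ).compLinearMap f)

theorem wedgeProd_apply (f : Fin k → Module.Dual ℝ V) (v : Fin k → V) :
    wedgeProd f v = (Matrix.of fun p q => f p (v q)).det := by
  rw [← Matrix.det_transpose, Matrix.det_apply]
  simp [wedgeProd, MultilinearMap.alternatization_apply]

theorem wedge_wedgeProd (f : Fin k → Module.Dual ℝ V) (g : Fin l → Module.Dual ℝ V) :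
    wedge (wedgeProd f) (wedgeProd g) = wedgeProd (Fin.append f g) := by
  ext v
  rw [wedgeProd_apply, ← Matrix.det_submatrix_equiv_self finSumFinEquiv, ← Matrix.det_transpose,
    Matrix.det_apply]
  unfold wedge wedgeProd
  rw [← MultilinearMap.domCoprod_alternization]
  simp only [AlternatingMap.domDomCongr_apply, LinearMap.compAlternatingMap_apply,
    MultilinearMap.alternatization_apply, map_sum]
  refine Finset.sum_congr rfl fun σ _ => ?_
  rw [Units.smul_def, Units.smul_def]
  refine (map_zsmul (LinearMap.mul' ℝ ℝ) _ _).trans (congrArg _ ?_)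
  simp

theorem wedge_wedgeProd_comp {ι : Type*} (f : ι → Module.Dual ℝ V) (x : Fin k → ι)
    (y : Fin l → ι) :
    wedge (wedgeProd (f ∘ x)) (wedgeProd (f ∘ y)) = wedgeProd (f ∘ Fin.append x y) := by
  rw [wedge_wedgeProd]
  congr 1
  ext1 p
  refine Fin.addCases (fun p => ?_) (fun p => ?_) p <;> simp

theorem interior_wedgeProd (u : V) (f : Fin (k + 1) → Module.Dual ℝ V) :
    interior u (wedgeProd f) =
      ∑ p : Fin (k + 1), ((-1) ^ (p : ℕ) * f p u) • wedgeProd (f ∘ p.succAbove) := by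
  ext v
  rw [interior_apply, wedgeProd_apply, Matrix.det_succ_column_zero, sum_form_apply]
  simp [wedgeProd_apply, Matrix.submatrix]

theorem wedgeProd_coord_comp (b : Module.Basis (Fin n) ℝ V) (x : Fin n → Fin n) :
    wedgeProd (b.coord ∘ x) b = leviCivita (List.ofFn x) := by
  have hrows : (Matrix.of fun p q => (b.coord ∘ x) p (b q)) =
      ((1 : Matrix (Fin n) (Fin n) ℝ) : Fin n → Fin n → ℝ) ∘ x := by
    ext p q
    rw [Matrix.of_apply, Function.comp_apply, b.coord_apply, b.repr_self_apply]
    exact (if_congr eq_comm rfl rfl).trans Matrix.one_apply.symm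
  rw [wedgeProd_apply, hrows]
  refine (map_comp_eq_leviCivita_mul Matrix.detRowAlternating (1 : Matrix _ _ ℝ) x).trans ?_
  exact (congrArg _ Matrix.det_one).trans (mul_one _)

end WedgeProd

section CoordForm

variable {k n N : ℕ}

/-- The form `∑ s, c s • e^{T s 0} ∧ … ∧ e^{T s (k-1)}` with integral coefficients, for the basis
`e` dual to `b`. -/
def coordForm (b : Module.Basis (Fin n) ℝ V) (c : Fin N → ℤ) (T : Fin N → Fin k → Fin n) :
    V [⋀^Fin k]→ₗ[ℝ] ℝ :=
  ∑ s, (c s : ℝ) • wedgeProd (b.coord ∘ T s)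

theorem coordForm_comp (b : Module.Basis (Fin n) ℝ V) (c : Fin N → ℤ)
    (T : Fin N → Fin k → Fin n) (y : Fin k → Fin n) :
    coordForm b c T (b ∘ y) =
      ((∑ s, c s * (Matrix.of fun p q => if T s p = y q then 1 else 0).det : ℤ) : ℝ) := by
  rw [coordForm, sum_form_apply]
  push_cast
  refine Finset.sum_congr rfl fun s _ => ?_
  rw [AlternatingMap.smul_apply, wedgeProd_apply, smul_eq_mul]
  congr 2
  ext p q
  simp [Finsupp.single_apply, eq_comm]

theorem interior_coordForm (b : Module.Basis (Fin n) ℝ V) (c : Fin N → ℤ)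
    (T : Fin N → Fin (k + 1) → Fin n) (i : Fin n) :
    interior (b i) (coordForm b c T) = ∑ s, ∑ p : Fin (k + 1),
      ((if T s p = i then c s * (-1) ^ (p : ℕ) else 0 : ℤ) : ℝ) •
        wedgeProd (b.coord ∘ (T s ∘ p.succAbove)) := by
  change AlternatingMap.curryLeftLinearMap (coordForm b c T) (b i) = _
  rw [coordForm, map_sum, LinearMap.sum_apply]
  refine Finset.sum_congr rfl fun s _ => ?_
  rw [map_smul, LinearMap.smul_apply]
  change (c s : ℝ) • interior (b i) (wedgeProd (b.coord ∘ T s)) = _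
  rw [interior_wedgeProd, Finset.smul_sum]
  refine Finset.sum_congr rfl fun p _ => ?_
  rw [smul_smul]
  congr 1
  rw [Function.comp_apply, b.coord_apply, b.repr_self_apply, if_congr eq_comm rfl rfl]
  split_ifs <;> push_cast <;> ring

theorem bryantForm_coordForm (b : Module.Basis (Fin (k + k + (k + 1))) ℝ V) (c : Fin N → ℤ)
    (T : Fin N → Fin (k + 1) → Fin (k + k + (k + 1))) (i j : Fin (k + k + (k + 1))) :
    bryantForm (coordForm b c T) (b i) (b j) b =
      ((∑ r, c r * ∑ t, ∑ q, if T t q = j then c t * (-1) ^ (q : ℕ) *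
        ∑ s, ∑ p, if T s p = i then c s * (-1) ^ (p : ℕ) * leviCivita
          (List.ofFn (T s ∘ p.succAbove) ++ List.ofFn (T t ∘ q.succAbove) ++ List.ofFn (T r))
        else 0 else 0 : ℤ) : ℝ) := by
  have hterm (s t r : Fin N) (p q : Fin (k + 1)) : wedge (wedge
      (wedgeProd (b.coord ∘ (T s ∘ p.succAbove))) (wedgeProd (b.coord ∘ (T t ∘ q.succAbove))))
      (wedgeProd (b.coord ∘ T r)) b = (leviCivita (List.ofFn (T s ∘ p.succAbove) ++
        List.ofFn (T t ∘ q.succAbove) ++ List.ofFn (T r)) : ℝ) := by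
    rw [wedge_wedgeProd_comp, wedge_wedgeProd_comp, wedgeProd_coord_comp, List.ofFn_fin_append,
      List.ofFn_fin_append]
  rw [bryantForm_apply, interior_coordForm, interior_coordForm]
  conv_lhs => enter [1, 2]; rw [coordForm]
  simp only [← wedgeHom_apply, map_sum, map_smul, LinearMap.sum_apply, LinearMap.smul_apply,
    sum_form_apply, AlternatingMap.smul_apply]
  simp only [wedgeHom_apply, hterm, smul_eq_mul]
  push_cast
  simp only [ite_mul, zero_mul]

end CoordForm

section StandardForm

/-- The indices of the seven monomials of the standard positive form. -/
def stdTriple : Fin 7 → Fin 3 → Fin 7 :=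
  ![![0, 1, 2], ![0, 5, 6], ![4, 1, 6], ![4, 5, 2], ![3, 0, 4], ![3, 1, 5], ![3, 2, 6]]

/-- The coefficients of the seven monomials of the standard positive form. -/
def stdCoeff : Fin 7 → ℤ :=
  ![1, -1, -1, -1, -1, -1, -1]

/-- The positive form which is standard in the basis `b`. -/
def stdForm (b : Module.Basis (Fin 7) ℝ V) : V [⋀^Fin 3]→ₗ[ℝ] ℝ :=
  coordForm b stdCoeff stdTriple

theorem IsPositive.exists_eq_stdForm {φ : V [⋀^Fin 3]→ₗ[ℝ] ℝ} (hφ : IsPositive φ) :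
    ∃ b : Module.Basis (Fin 7) ℝ V, φ = stdForm b := by
  obtain ⟨b, hb⟩ := hφ
  refine ⟨b, AlternatingMap.ext fun v => (hb v).trans ?_⟩
  have htriple (i j k : Fin 7) : dualTriple b i j k v = wedgeProd (b.coord ∘ ![i, j, k]) v :=
    (wedgeProd_apply _ _).symm
  simp only [htriple, stdForm, coordForm, Fin.sum_univ_seven]
  simp [stdCoeff, stdTriple]
  ring

theorem bryantForm_stdForm_basis (b : Module.Basis (Fin 7) ℝ V) (i j : Fin 7) :
    bryantForm (stdForm b) (b i) (b j) b = if i = j then -6 else 0 := by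
  have htable : ∀ i j, (∑ r, stdCoeff r * ∑ t, ∑ q, if stdTriple t q = j then
      stdCoeff t * (-1) ^ (q : ℕ) * ∑ s, ∑ p, if stdTriple s p = i then
        stdCoeff s * (-1) ^ (p : ℕ) * leviCivita (List.ofFn (stdTriple s ∘ p.succAbove) ++
          List.ofFn (stdTriple t ∘ q.succAbove) ++ List.ofFn (stdTriple r))
      else 0 else 0 : ℤ) = if i = j then -6 else 0 := by
    decide +kernel
  rw [stdForm, bryantForm_coordForm (k := 2), htable]
  split_ifs <;> simp

theorem bryantForm_stdForm (b : Module.Basis (Fin 7) ℝ V) (u w : V) (v : Fin 7 → V) :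
    bryantForm (stdForm b) u w v = -6 * (∑ i, b.repr u i * b.repr w i) * b.det v := by
  rw [bryantForm_apply_of_diagonal (k := 2) (stdForm b) b
    fun i j => by rw [bryantForm_stdForm_basis b i j]]

end StandardForm

/-! ### Metric, volume form and dual form of the standard form -/

section Contraction

variable {ι κ : Type*} [Fintype ι] [DecidableEq ι] [Fintype κ] {k n : ℕ}

theorem sum_prod_toMatrix_mul_transpose (b b₀ : Module.Basis κ ℝ V)
    (F E : MultilinearMap ℝ (fun _ : ι => V) ℝ) :
    ∑ y : ι → κ, (∑ x : ι → κ,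
        F (b ∘ x) * ∏ p, (b.toMatrix b₀ * (b.toMatrix b₀)ᵀ) (x p) (y p)) * E (b ∘ y) =
      ∑ z : ι → κ, F (b₀ ∘ z) * E (b₀ ∘ z) := by
  have hprod (x y : ι → κ) : ∏ p, (b.toMatrix b₀ * (b.toMatrix b₀)ᵀ) (x p) (y p) =
      ∑ z : ι → κ, (∏ p, b.repr (b₀ (z p)) (x p)) * ∏ p, b.repr (b₀ (z p)) (y p) := by
    simp only [Matrix.mul_apply, Matrix.transpose_apply, Module.Basis.toMatrix_apply,
      Finset.prod_univ_sum, Fintype.piFinset_univ, Finset.prod_mul_distrib]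
  have hexpand (z : ι → κ) : F (b₀ ∘ z) * E (b₀ ∘ z) = ∑ y : ι → κ, ∑ x : ι → κ,
      F (b ∘ x) * ((∏ p, b.repr (b₀ (z p)) (x p)) * ∏ p, b.repr (b₀ (z p)) (y p)) * E (b ∘ y) := by
    rw [← sum_prod_repr_mul_map b F, ← sum_prod_repr_mul_map b E, Finset.sum_mul_sum,
      Finset.sum_comm]
    exact Finset.sum_congr rfl fun y _ => Finset.sum_congr rfl fun x _ => by
      simp only [Function.comp_apply]
      ring
  simp only [hprod, hexpand, Finset.mul_sum, Finset.sum_mul]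
  rw [Finset.sum_congr rfl fun y _ => Finset.sum_comm, Finset.sum_comm]

theorem sum_wedgeProd_coord_mul (b : Module.Basis (Fin n) ℝ V) (x : Fin k → Fin n)
    (E : V [⋀^Fin k]→ₗ[ℝ] ℝ) :
    ∑ y : Fin k → Fin n, wedgeProd (b.coord ∘ x) (b ∘ y) * E (b ∘ y) =
      k.factorial * E (b ∘ x) := by
  have hexpand : ∑ y : Fin k → Fin n, (∏ p, b.coord (x p) (b (y p))) * E (b ∘ y) = E (b ∘ x) := by
    refine (Finset.sum_congr rfl fun y _ => ?_).trans
      (sum_prod_repr_mul_map b E.toMultilinearMap (b ∘ x))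
    exact congrArg (· * E (b ∘ y)) <| Finset.prod_congr rfl fun p _ => by
      simp [Finsupp.single_apply, eq_comm]
  have hperm (σ : Equiv.Perm (Fin k)) : ∑ y : Fin k → Fin n,
      ((σ.sign : ℤ) : ℝ) * (∏ p, b.coord (x p) (b (y (σ p)))) * E (b ∘ y) = E (b ∘ x) := by
    rw [← (σ.arrowCongr (Equiv.refl (Fin n))).sum_comp, ← hexpand]
    refine Finset.sum_congr rfl fun y _ => ?_
    have hsign : E (b ∘ (y ∘ σ.symm)) = ((σ.sign : ℤ) : ℝ) * E (b ∘ y) := by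
      rw [← Function.comp_assoc, E.map_perm, Equiv.Perm.sign_symm, Units.smul_def, zsmul_eq_mul]
    have hone : ((σ.sign : ℤ) : ℝ) * ((σ.sign : ℤ) : ℝ) = 1 := by
      rw [← Int.cast_mul, ← Units.val_mul, Int.units_mul_self, Units.val_one, Int.cast_one]
    change _ * (∏ p, b.coord (x p) (b (y (σ.symm (σ p))))) * E (b ∘ (y ∘ σ.symm)) = _
    simp only [σ.symm_apply_apply, hsign]
    linear_combination (∏ p, b.coord (x p) (b (y p))) * E (b ∘ y) * hone
  have hdet (y : Fin k → Fin n) : wedgeProd (b.coord ∘ x) (b ∘ y) =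
      ∑ σ : Equiv.Perm (Fin k), ((σ.sign : ℤ) : ℝ) * ∏ p, b.coord (x p) (b (y (σ p))) := by
    rw [wedgeProd_apply, ← Matrix.det_transpose, Matrix.det_apply']
    rfl
  simp only [hdet, Finset.sum_mul]
  rw [Finset.sum_comm, Finset.sum_congr rfl fun σ _ => hperm σ, Finset.sum_const, nsmul_eq_mul,
    Finset.card_univ, Fintype.card_perm, Fintype.card_fin]

theorem sum_coordForm_mul {N : ℕ} (b : Module.Basis (Fin n) ℝ V) (c : Fin N → ℤ)
    (T : Fin N → Fin k → Fin n) (E : V [⋀^Fin k]→ₗ[ℝ] ℝ) :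
    ∑ y : Fin k → Fin n, coordForm b c T (b ∘ y) * E (b ∘ y) =
      k.factorial * ∑ s, c s * E (b ∘ T s) := by
  simp only [coordForm, sum_form_apply, AlternatingMap.smul_apply, smul_eq_mul, Finset.sum_mul]
  rw [Finset.sum_comm, Finset.mul_sum]
  refine Finset.sum_congr rfl fun s _ => ?_
  simp only [mul_assoc, ← Finset.mul_sum, sum_wedgeProd_coord_mul]
  exact mul_left_comm _ _ _

theorem sum_vecCons {f : (Fin (k + 1) → κ) → ℝ} :
    ∑ x, f x = ∑ a, ∑ y, f (Matrix.vecCons a y) := by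
  rw [← (Fin.consEquiv fun _ => κ).sum_comp, Fintype.sum_prod_type]
  rfl

/-- The alternating form obtained from `η` by fixing its last arguments to be `v`. -/
def fixRight {l : ℕ} (η : V [⋀^Fin (k + l)]→ₗ[ℝ] ℝ) (v : Fin l → V) : V [⋀^Fin k]→ₗ[ℝ] ℝ :=
  let ζ := η.domDomCongr finSumFinEquiv.symm
  { toFun w := ζ (Sum.elim w v)
    map_update_add' w p x y := by
      simp only [← Sum.update_elim_inl, ζ.map_update_add]
    map_update_smul' w p r x := by
      simp only [← Sum.update_elim_inl, ζ.map_update_smul]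
    map_eq_zero_of_eq' w i j hw hij :=
      ζ.map_eq_zero_of_eq _ (i := .inl i) (j := .inl j) hw (Sum.inl_injective.ne hij) }

theorem fixRight_apply {l : ℕ} (η : V [⋀^Fin (k + l)]→ₗ[ℝ] ℝ) (v : Fin l → V) (w : Fin k → V) :
    fixRight η v w = η (Fin.append w v) := by
  refine congrArg η (funext fun p => ?_)
  refine Fin.addCases (fun p => ?_) (fun p => ?_) p <;> simp

theorem dualForm_apply (φ : V [⋀^Fin 3]→ₗ[ℝ] ℝ) (b : Module.Basis (Fin 7) ℝ V) (v : Fin 4 → V) :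
    dualForm φ b v = 1 / 6 * ∑ y : Fin 3 → Fin 7,
      (∑ x : Fin 3 → Fin 7, φ (b ∘ x) * ∏ p, metricInv φ b (x p) (y p)) *
        fixRight (k := 3) (volForm φ b) v (b ∘ y) := by
  have hinterior (a c d : Fin 7) :
      interior (b d) (interior (b c) (interior (b a) (volForm φ b))) v =
        fixRight (k := 3) (volForm φ b) v (b ∘ ![a, c, d]) := by
    rw [fixRight_apply, interior_apply, interior_apply, interior_apply]
    congr 1
    ext p
    fin_cases p <;> rfl
  have hframe (p q r : Fin 7) : b ∘ ![p, q, r] = ![b p, b q, b r] := comp_eq_vecCons b _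
  simp only [dualForm, sum_form_apply, AlternatingMap.smul_apply, smul_eq_mul, hinterior,
    sum_vecCons, Fintype.sum_unique, Subsingleton.elim default ![]]
  simp [hframe, Fin.prod_univ_three]

end Contraction

section StandardFrame

open Matrix Module

variable (b₀ b : Basis (Fin 7) ℝ V)

theorem tensorB_stdForm :
    tensorB (stdForm b₀) b =
      (-6 * (b₀.toMatrix b).det) • ((b₀.toMatrix b)ᵀ * b₀.toMatrix b) := by
  ext i j
  rw [tensorB_apply, bryantForm_stdForm, b₀.det_apply, Matrix.smul_apply, Matrix.mul_apply,
    smul_eq_mul]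
  simp only [transpose_apply, Basis.toMatrix_apply]
  ring

theorem root9_det_tensorB_stdForm :
    root9 (tensorB (stdForm b₀) b).det = -((6 : ℝ) ^ ((7 : ℝ) / 9) * (b₀.toMatrix b).det) := by
  have hsix : ((6 : ℝ) ^ ((7 : ℝ) / 9)) ^ 9 = 6 ^ 7 := by
    rw [← Real.rpow_natCast, ← Real.rpow_mul (by norm_num)]
    norm_num
  have hpow : (tensorB (stdForm b₀) b).det =
      (-((6 : ℝ) ^ ((7 : ℝ) / 9) * (b₀.toMatrix b).det)) ^ 9 := by
    rw [tensorB_stdForm, det_smul, det_mul, det_transpose, Fintype.card_fin]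
    linear_combination (b₀.toMatrix b).det ^ 9 * hsix
  rw [hpow, root9_pow_nine]

theorem metric_stdForm : metric (stdForm b₀) b = (b₀.toMatrix b)ᵀ * b₀.toMatrix b := by
  have hsix : (6 : ℝ) ^ ((2 : ℝ) / 9) * 6 ^ ((7 : ℝ) / 9) = 6 := by
    rw [← Real.rpow_add (by norm_num)]
    norm_num
  have hdet : (b₀.toMatrix b).det ≠ 0 := b₀.det_apply b ▸ (b₀.isUnit_det b).ne_zero
  ext i j
  rw [metric, of_apply, root9_det_tensorB_stdForm, tensorB_stdForm, Matrix.smul_apply, smul_eq_mul]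
  field_simp
  linear_combination -((b₀.toMatrix b)ᵀ * b₀.toMatrix b) i j * hsix

theorem metricInv_stdForm :
    metricInv (stdForm b₀) b = b.toMatrix b₀ * (b.toMatrix b₀)ᵀ := by
  rw [metricInv, metric_stdForm, Matrix.mul_inv_rev, ← transpose_nonsing_inv,
    inv_eq_right_inv (b₀.toMatrix_mul_toMatrix_flip b)]

theorem volForm_stdForm : volForm (stdForm b₀) b = b₀.det := by
  rw [b₀.det.eq_smul_basis_det b, volForm, root9_det_tensorB_stdForm, b₀.det_apply]
  congr 1
  field_simp

theorem dualForm_stdForm (v : Fin 4 → V) :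
    dualForm (stdForm b₀) b v =
      ∑ s, stdCoeff s * b₀.det (Fin.append (b₀ ∘ stdTriple s) v) := by
  have hcontract := sum_prod_toMatrix_mul_transpose b b₀ (stdForm b₀).toMultilinearMap
    (fixRight (k := 3) b₀.det v).toMultilinearMap
  simp only [AlternatingMap.coe_multilinearMap] at hcontract
  rw [dualForm_apply, metricInv_stdForm, volForm_stdForm, hcontract, stdForm, sum_coordForm_mul]
  simp only [fixRight_apply]
  rw [← mul_assoc, show (1 / 6 : ℝ) * (Nat.factorial 3 : ℕ) = 1 by norm_num [Nat.factorial],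
    one_mul]

end StandardFrame

/-! ### The cross product -/

section CrossProduct

theorem alternatingMap_ext_of_strictMono {κ : Type*} [LinearOrder κ] {k : ℕ}
    (b : Module.Basis κ ℝ V) {α β : V [⋀^Fin k]→ₗ[ℝ] ℝ}
    (h : ∀ x : Fin k → κ, StrictMono x → α (b ∘ x) = β (b ∘ x)) : α = β := by
  refine b.ext_alternating fun x hx => ?_
  have hsort := (Tuple.monotone_sort x).strictMono_of_injective (hx.comp (Tuple.sort x).injective)
  have hperm := h _ hsort
  rw [← Function.comp_assoc, α.map_perm, β.map_perm] at hperm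
  exact smul_left_cancel _ hperm

variable {κ : Type*} [Fintype κ] (b : Module.Basis κ ℝ V) (φ : V [⋀^Fin 3]→ₗ[ℝ] ℝ)

/-- The cross product of a `3`-form `φ`, given by `⟨u × w, v⟩ = φ(u, w, v)` for the inner product in
which `b` is orthonormal. -/
def crossProduct : V →ₗ[ℝ] Module.End ℝ V :=
  LinearMap.mk₂ ℝ (fun u w => ∑ l, interior w (interior u φ) ![b l] • b l)
    (fun u u' w => by simp [interior, add_smul, Finset.sum_add_distrib])
    (fun r u w => by simp [interior, mul_smul, Finset.smul_sum])
    (fun u w w' => by simp [interior, add_smul, Finset.sum_add_distrib])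
    (fun r u w => by simp [interior, mul_smul, Finset.smul_sum])

theorem crossProduct_apply (u w : V) : crossProduct b φ u w = ∑ l, φ ![u, w, b l] • b l :=
  rfl

theorem sum_repr_crossProduct_mul_repr (u w v : V) :
    ∑ l, b.repr (crossProduct b φ u w) l * b.repr v l = φ ![u, w, v] := by
  have hupdate (x : V) : Function.update ![u, w, v] 2 x = ![u, w, x] := by
    ext p
    fin_cases p <;> rfl
  rw [← hupdate v, ← sum_repr_mul_map_update φ b]
  refine Finset.sum_congr rfl fun l _ => ?_
  rw [crossProduct_apply, b.repr_sum_self, hupdate, mul_comm]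

theorem sum_repr_crossProduct_skew (u w v : V) :
    ∑ l, b.repr (crossProduct b φ u w) l * b.repr v l +
      ∑ l, b.repr w l * b.repr (crossProduct b φ u v) l = 0 := by
  have hswap : ![u, v, w] = ![u, w, v] ∘ Equiv.swap 1 2 := by
    ext p
    fin_cases p <;> rfl
  simp only [mul_comm (b.repr w _), sum_repr_crossProduct_mul_repr]
  rw [hswap, φ.map_swap _ (by decide), add_neg_cancel]

theorem trace_crossProduct (u : V) : LinearMap.trace ℝ V (crossProduct b φ u) = 0 := by
  classical
  rw [LinearMap.trace_eq_matrix_trace ℝ b]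
  refine Finset.sum_eq_zero fun i _ => ?_
  rw [Matrix.diag_apply, LinearMap.toMatrix_apply, crossProduct_apply, b.repr_sum_self]
  exact φ.map_eq_zero_of_eq _ (i := 1) (j := 2) rfl (by decide)

end CrossProduct

section StandardCrossProduct

variable (b : Module.Basis (Fin 7) ℝ V)

/-- The index `d` for which `e_a × e_c = ± e_d`, for the cross product of the standard positive form
and `a ≠ c`. -/
def stdCross : Fin 7 → Fin 7 → Fin 7 :=
  ![![0, 2, 1, 4, 3, 6, 5],
    ![2, 0, 0, 5, 6, 3, 4],
    ![1, 0, 0, 6, 5, 4, 3],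
    ![4, 5, 6, 0, 0, 1, 2],
    ![3, 6, 5, 0, 0, 2, 1],
    ![6, 3, 4, 1, 2, 0, 0],
    ![5, 4, 3, 2, 1, 0, 0]]

/-- The sign in `e_a × e_c = ± e_d`, for the cross product of the standard positive form, and `0` if
`a = c`. -/
def stdSign : Fin 7 → Fin 7 → ℤ :=
  ![![0, 1, -1, 1, -1, -1, 1],
    ![-1, 0, 1, 1, 1, -1, -1],
    ![1, -1, 0, 1, -1, 1, -1],
    ![-1, -1, -1, 0, 1, 1, 1],
    ![1, -1, 1, -1, 0, -1, 1],
    ![1, 1, -1, -1, 1, 0, -1],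
    ![-1, 1, 1, -1, -1, 1, 0]]

theorem stdForm_comp (y : Fin 3 → Fin 7) :
    stdForm b (b ∘ y) =
      ((if stdCross (y 0) (y 1) = y 2 then stdSign (y 0) (y 1) else 0 : ℤ) : ℝ) := by
  have htable : ∀ a c d, ∑ s, stdCoeff s *
      (Matrix.of fun p q => if stdTriple s p = ![a, c, d] q then (1 : ℤ) else 0).det =
      if stdCross a c = d then stdSign a c else 0 := by
    simp only [Matrix.det_fin_three]
    decide +kernel
  have hy : y = ![y 0, y 1, y 2] := comp_eq_vecCons id y
  rw [stdForm, coordForm_comp, ← htable, ← hy]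

theorem crossProduct_stdForm_basis (a c : Fin 7) :
    crossProduct b (stdForm b) (b a) (b c) = (stdSign a c : ℝ) • b (stdCross a c) := by
  have hframe (d : Fin 7) : ![b a, b c, b d] = b ∘ ![a, c, d] :=
    (comp_eq_vecCons b ![a, c, d]).symm
  simp only [crossProduct_apply, hframe, stdForm_comp, Int.cast_ite, ite_smul]
  simp

theorem dualForm_stdForm_comp (b' : Module.Basis (Fin 7) ℝ V) (y : Fin 4 → Fin 7) :
    dualForm (stdForm b) b' (b ∘ y) =
      ((∑ s, stdCoeff s * leviCivita (List.ofFn (stdTriple s) ++ List.ofFn y) : ℤ) : ℝ) := by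
  have happend (s : Fin 7) : (Fin.append (b ∘ stdTriple s) (b ∘ y) : Fin 7 → V) =
      b ∘ (Fin.append (stdTriple s) y : Fin 7 → Fin 7) := by
    ext p
    refine Fin.addCases (m := 3) (fun p => ?_) (fun p => ?_) p <;> simp
  rw [dualForm_stdForm]
  push_cast
  refine Finset.sum_congr rfl fun s _ => ?_
  rw [happend, map_comp_eq_leviCivita_mul, b.det_self, mul_one]
  exact congrArg _ (congrArg _ (congrArg _ (List.ofFn_fin_append _ _)))

/-- In components, the derivation `e_m × ·` takes the standard form to `-3 e_m ⌟ ψ`. -/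
theorem stdCross_derivation_eq : ∀ m i j k : Fin 7, i < j → j < k →
    stdSign m i * (if stdCross (stdCross m i) j = k then stdSign (stdCross m i) j else 0) +
      stdSign m j * (if stdCross i (stdCross m j) = k then stdSign i (stdCross m j) else 0) +
      stdSign m k * (if stdCross i j = stdCross m k then stdSign i j else 0) =
    -3 * ∑ s, stdCoeff s * leviCivita (List.ofFn (stdTriple s) ++ [m, i, j, k]) := by
  decide +kernel

theorem endAction_crossProduct_stdForm_basis (m : Fin 7) {y : Fin 3 → Fin 7} (hy : StrictMono y) :
    endAction (stdForm b) (crossProduct b (stdForm b) (b m)) (b ∘ y) =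
      -3 * ((∑ s, stdCoeff s *
        leviCivita (List.ofFn (stdTriple s) ++ m :: List.ofFn y) : ℤ) : ℝ) := by
  have hupdate (p : Fin 3) (a : Fin 7) :
      Function.update (b ∘ y) p (b a) = b ∘ Function.update y p a :=
    (Function.comp_update b y p a).symm
  have htable := stdCross_derivation_eq m (y 0) (y 1) (y 2) (hy (by decide)) (hy (by decide))
  have hlist : List.ofFn y = [y 0, y 1, y 2] := by simp [List.ofFn_succ]
  rw [hlist, endAction_apply, Fin.sum_univ_three, ← Int.cast_ofNat, ← Int.cast_neg,
    ← Int.cast_mul, ← htable]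
  simp only [Function.comp_apply, crossProduct_stdForm_basis, AlternatingMap.map_update_smul,
    hupdate, stdForm_comp]
  simp

theorem endAction_crossProduct_stdForm (b' : Module.Basis (Fin 7) ℝ V) (X : V) :
    endAction (stdForm b) (crossProduct b (stdForm b) X) =
      (-3 : ℝ) • interior X (dualForm (stdForm b) b') := by
  have hbasis (m : Fin 7) : endAction (stdForm b) (crossProduct b (stdForm b) (b m)) =
      (-3 : ℝ) • interior (b m) (dualForm (stdForm b) b') := by
    refine alternatingMap_ext_of_strictMono b fun y hy => ?_
    have hcons : Matrix.vecCons (b m) (b ∘ y) = b ∘ Matrix.vecCons m y :=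
      (Fin.comp_cons b m y).symm
    rw [endAction_crossProduct_stdForm_basis b m hy, AlternatingMap.smul_apply, interior_apply,
      hcons, dualForm_stdForm_comp, Matrix.vecCons, List.ofFn_cons, smul_eq_mul]
  have hlinear : endAction (stdForm b) ∘ₗ crossProduct b (stdForm b) =
      (-3 : ℝ) • AlternatingMap.curryLeftLinearMap (dualForm (stdForm b) b') :=
    b.ext hbasis
  exact LinearMap.congr_fun hlinear X

theorem bryantForm_crossProduct_skew (X u w : V) :
    bryantForm (stdForm b) (crossProduct b (stdForm b) X u) w +
      bryantForm (stdForm b) u (crossProduct b (stdForm b) X w) = 0 := by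
  ext v
  rw [AlternatingMap.add_apply, bryantForm_stdForm b _ _ v, bryantForm_stdForm b _ _ v, ← add_mul,
    ← mul_add, sum_repr_crossProduct_skew, mul_zero, zero_mul, AlternatingMap.zero_apply]

end StandardCrossProduct

theorem IsPositive.exists_skew_endAction_eq_interior_dualForm {φ : V [⋀^Fin 3]→ₗ[ℝ] ℝ}
    (hφ : IsPositive φ) (b : Module.Basis (Fin 7) ℝ V) (X : V) :
    ∃ Y : Module.End ℝ V, endAction φ Y = interior X (dualForm φ b) ∧
      LinearMap.trace ℝ V Y = 0 ∧
      ∀ u w, bryantForm φ (Y u) w + bryantForm φ u (Y w) = 0 := by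
  obtain ⟨b₀, rfl⟩ := hφ.exists_eq_stdForm
  refine ⟨-(1 / 3 : ℝ) • crossProduct b₀ (stdForm b₀) X, ?_, ?_, fun u w => ?_⟩
  · rw [map_smul, endAction_crossProduct_stdForm b₀ b, smul_smul]
    norm_num
  · rw [map_smul, trace_crossProduct, smul_zero]
  · rw [LinearMap.smul_apply, LinearMap.smul_apply, map_smul, map_smul, LinearMap.smul_apply,
      ← smul_add, bryantForm_crossProduct_skew, smul_zero]

/-! ### Evolution under the flow -/

section RaiseEnd

variable (φ : V [⋀^Fin 3]→ₗ[ℝ] ℝ) (h : LinearMap.BilinForm ℝ V) (b : Module.Basis (Fin 7) ℝ V)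

/-- The matrix of the endomorphism `h^l_i` in the frame `b`. -/
def raiseMatrix : Matrix (Fin 7) (Fin 7) ℝ :=
  metricInv φ b * tensorComp h b

theorem raiseMatrix_apply (l i : Fin 7) : raiseMatrix φ h b l i = raiseOne φ h b l i :=
  rfl

theorem flowRHS_eq (X : V) (x : Fin 3 → Fin 7) :
    flowRHS φ h X b (x 0) (x 1) (x 2) =
      (endAction φ (Matrix.toLin b b (raiseMatrix φ h b)) + interior X (dualForm φ b)) (b ∘ x) := by
  have hH (p : Fin 3) : φ (Function.update (b ∘ x) p
      (Matrix.toLin b b (raiseMatrix φ h b) ((b ∘ x) p))) =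
        ∑ l, raiseOne φ h b l (x p) * φ (Function.update (b ∘ x) p (b l)) := by
    rw [← sum_repr_mul_map_update φ b]
    simp only [Function.comp_apply, Matrix.toLin_self, b.repr_sum_self, raiseMatrix_apply]
  have hX : interior X (dualForm φ b) (b ∘ x) =
      ∑ l, b.repr X l * dualForm φ b (Matrix.vecCons (b l) (b ∘ x)) := by
    have hcons (w : V) :
        Function.update (Matrix.vecCons X (b ∘ x)) 0 w = Matrix.vecCons w (b ∘ x) :=
      Fin.update_cons_zero _ _ _
    have hsum := sum_repr_mul_map_update (dualForm φ b) b (Matrix.vecCons X (b ∘ x)) 0 X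
    simp only [hcons] at hsum
    rw [interior_apply, hsum]
  have hupdate (w : V) : Function.update (b ∘ x) 0 w = ![w, b (x 1), b (x 2)] ∧
      Function.update (b ∘ x) 1 w = ![b (x 0), w, b (x 2)] ∧
      Function.update (b ∘ x) 2 w = ![b (x 0), b (x 1), w] := by
    refine ⟨?_, ?_, ?_⟩ <;> ext p <;> fin_cases p <;> rfl
  rw [AlternatingMap.add_apply, hX, endAction_apply, Fin.sum_univ_three, hH, hH, hH]
  simp only [(hupdate _).1, (hupdate _).2.1, (hupdate _).2.2, ← Finset.sum_add_distrib]
  rw [comp_eq_vecCons b x]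
  rfl

end RaiseEnd

section MatrixEvolution

variable {ι : Type*} [Fintype ι] [DecidableEq ι]

theorem trace_adjugate_mul_add (A H : Matrix ι ι ℝ) (τ : ℝ) :
    (A.adjugate * (τ • A + Hᵀ * A + A * H)).trace =
      (Fintype.card ι * τ + 2 * H.trace) * A.det := by
  rw [Matrix.mul_add, Matrix.mul_add, Matrix.trace_add, Matrix.trace_add, Matrix.mul_smul,
    Matrix.adjugate_mul, Matrix.trace_mul_comm _ (Hᵀ * A), Matrix.mul_assoc,
    Matrix.mul_adjugate, ← Matrix.mul_assoc, Matrix.adjugate_mul]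
  simp only [Matrix.trace_smul, Matrix.trace_one, Matrix.mul_smul, Matrix.smul_mul, Matrix.mul_one,
    Matrix.one_mul, Matrix.trace_transpose, smul_eq_mul]
  ring

variable {φ : ℝ → V [⋀^Fin 3]→ₗ[ℝ] ℝ} {b : Module.Basis (Fin 7) ℝ V}
  {H : Matrix (Fin 7) (Fin 7) ℝ} {J : Set ℝ} {t : ℝ}

theorem hasDerivWithinAt_root9_det_tensorB
    (hB : ∀ i j, HasDerivWithinAt (fun s => tensorB (φ s) b i j)
      ((H.trace • tensorB (φ t) b + Hᵀ * tensorB (φ t) b + tensorB (φ t) b * H) i j) J t)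
    (h0 : (tensorB (φ t) b).det ≠ 0) :
    HasDerivWithinAt (fun s => root9 (tensorB (φ s) b).det)
      (H.trace * root9 (tensorB (φ t) b).det) J t := by
  refine ((hasDerivAt_root9 h0).comp_hasDerivWithinAt t (hasDerivWithinAt_det hB)).congr_deriv ?_
  rw [trace_adjugate_mul_add, Fintype.card_fin]
  field_simp
  norm_num
  ring

theorem hasDerivWithinAt_volForm {c : ℝ}
    (hdet : HasDerivWithinAt (fun s => root9 (tensorB (φ s) b).det)
      (c * root9 (tensorB (φ t) b).det) J t) (v : Fin 7 → V) :
    HasDerivWithinAt (fun s => volForm (φ s) b v) (c * volForm (φ t) b v) J t := by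
  simp only [volForm, AlternatingMap.smul_apply, smul_eq_mul]
  refine ((hdet.const_mul _).mul_const _).congr_deriv ?_
  ring

theorem hasDerivWithinAt_metric
    (hB : ∀ i j, HasDerivWithinAt (fun s => tensorB (φ s) b i j)
      ((H.trace • tensorB (φ t) b + Hᵀ * tensorB (φ t) b + tensorB (φ t) b * H) i j) J t)
    (h0 : (tensorB (φ t) b).det ≠ 0) (i j : Fin 7) :
    HasDerivWithinAt (fun s => metric (φ s) b i j)
      ((Hᵀ * metric (φ t) b + metric (φ t) b * H) i j) J t := by
  have hr := root9_ne_zero h0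
  have hmetric : metric (φ t) b =
      (1 / (6 : ℝ) ^ ((2 : ℝ) / 9) / root9 (tensorB (φ t) b).det) • tensorB (φ t) b := by
    ext i j
    rw [metric, Matrix.of_apply, Matrix.smul_apply, smul_eq_mul]
    ring
  refine (((hB i j).div (hasDerivWithinAt_root9_det_tensorB hB h0) hr).const_mul
    (1 / (6 : ℝ) ^ ((2 : ℝ) / 9))).congr_deriv ?_
  rw [hmetric, Matrix.mul_smul, Matrix.smul_mul, ← smul_add, Matrix.add_apply, Matrix.add_apply,
    Matrix.smul_apply, Matrix.smul_apply, Matrix.add_apply, smul_eq_mul, smul_eq_mul]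
  field_simp
  ring

end MatrixEvolution

section Flow

variable {φ : V [⋀^Fin 3]→ₗ[ℝ] ℝ}

theorem IsPositive.det_tensorB_ne_zero (hφ : IsPositive φ) (b : Module.Basis (Fin 7) ℝ V) :
    (tensorB φ b).det ≠ 0 := by
  obtain ⟨b₀, rfl⟩ := hφ.exists_eq_stdForm
  have hdet : (b₀.toMatrix b).det ≠ 0 := b₀.det_apply b ▸ (b₀.isUnit_det b).ne_zero
  rw [tensorB_stdForm, Matrix.det_smul, Matrix.det_mul, Matrix.det_transpose]
  positivity

theorem IsPositive.det_metric_ne_zero (hφ : IsPositive φ) (b : Module.Basis (Fin 7) ℝ V) :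
    (metric φ b).det ≠ 0 := by
  obtain ⟨b₀, rfl⟩ := hφ.exists_eq_stdForm
  have hdet : (b₀.toMatrix b).det ≠ 0 := b₀.det_apply b ▸ (b₀.isUnit_det b).ne_zero
  rw [metric_stdForm, Matrix.det_mul, Matrix.det_transpose]
  positivity

theorem IsPositive.isSymm_metric (hφ : IsPositive φ) (b : Module.Basis (Fin 7) ℝ V) :
    (metric φ b).IsSymm := by
  obtain ⟨b₀, rfl⟩ := hφ.exists_eq_stdForm
  rw [metric_stdForm]
  exact Matrix.isSymm_transpose_mul_self _

theorem bryantForm_toLin_left (φ : V [⋀^Fin 3]→ₗ[ℝ] ℝ) (b : Module.Basis (Fin 7) ℝ V)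
    (H : Matrix (Fin 7) (Fin 7) ℝ) (i j : Fin 7) :
    bryantForm φ (Matrix.toLin b b H (b i)) (b j) b = (Hᵀ * tensorB φ b) i j := by
  simp only [Matrix.toLin_self, map_sum, map_smul, LinearMap.sum_apply, LinearMap.smul_apply,
    sum_form_apply, AlternatingMap.smul_apply, smul_eq_mul, tensorB_apply, Matrix.mul_apply,
    Matrix.transpose_apply]

theorem bryantForm_toLin_right (φ : V [⋀^Fin 3]→ₗ[ℝ] ℝ) (b : Module.Basis (Fin 7) ℝ V)
    (H : Matrix (Fin 7) (Fin 7) ℝ) (i j : Fin 7) :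
    bryantForm φ (b i) (Matrix.toLin b b H (b j)) b = (tensorB φ b * H) i j := by
  simp only [Matrix.toLin_self, map_sum, map_smul, sum_form_apply, AlternatingMap.smul_apply,
    smul_eq_mul, tensorB_apply, Matrix.mul_apply, mul_comm]

theorem IsPositive.hasDerivWithinAt_tensorB {φ : ℝ → V [⋀^Fin 3]→ₗ[ℝ] ℝ} {J : Set ℝ} {t : ℝ}
    (hφ : IsPositive (φ t)) {h : LinearMap.BilinForm ℝ V} {X : V} {b : Module.Basis (Fin 7) ℝ V}
    (hflow : ∀ i j k, HasDerivWithinAt (fun s => φ s ![b i, b j, b k])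
      (flowRHS (φ t) h X b i j k) J t) (i j : Fin 7) :
    HasDerivWithinAt (fun s => tensorB (φ s) b i j)
      (((raiseMatrix (φ t) h b).trace • tensorB (φ t) b +
        (raiseMatrix (φ t) h b)ᵀ * tensorB (φ t) b +
        tensorB (φ t) b * raiseMatrix (φ t) h b) i j) J t := by
  obtain ⟨Y, hY, hYtrace, hYskew⟩ := hφ.exists_skew_endAction_eq_interior_dualForm b X
  set H := raiseMatrix (φ t) h b with hH
  have hφ' : HasFormDerivWithinAt φ (endAction (φ t) (Matrix.toLin b b H + Y)) J t := by
    refine .of_basis b fun x => ?_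
    rw [map_add, hY, hH, ← flowRHS_eq, comp_eq_vecCons]
    exact hflow _ _ _
  have htrace : LinearMap.trace ℝ V (Matrix.toLin b b H) = H.trace := by
    rw [LinearMap.trace_eq_matrix_trace ℝ b, LinearMap.toMatrix_toLin]
  have hcancel := congrArg (· b) (hYskew (b i) (b j))
  simp only [AlternatingMap.add_apply, AlternatingMap.zero_apply] at hcancel
  simp only [tensorB_apply]
  refine (hasFormDerivWithinAt_bryantForm (k := 2) b hφ' (b i) (b j) b).congr_deriv ?_
  simp only [map_add, LinearMap.add_apply, AlternatingMap.add_apply, AlternatingMap.smul_apply,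
    Matrix.add_apply, Matrix.smul_apply, smul_eq_mul]
  rw [htrace, hYtrace, bryantForm_toLin_left, bryantForm_toLin_right, tensorB_apply]
  linear_combination hcancel

variable {h : LinearMap.BilinForm ℝ V}

theorem trace_raiseMatrix (hh : ∀ u v, h u v = h v u) (b : Module.Basis (Fin 7) ℝ V) :
    (raiseMatrix φ h b).trace = traceG φ h b := by
  simp only [Matrix.trace, Matrix.diag_apply, raiseMatrix, Matrix.mul_apply, traceG]
  exact Finset.sum_congr rfl fun i _ => Finset.sum_congr rfl fun j _ =>
    congrArg (_ * ·) (hh _ _)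

theorem IsPositive.transpose_raiseMatrix_mul_metric_add (hφ : IsPositive φ)
    (hh : ∀ u v, h u v = h v u) (b : Module.Basis (Fin 7) ℝ V) :
    (raiseMatrix φ h b)ᵀ * metric φ b + metric φ b * raiseMatrix φ h b =
      (2 : ℝ) • tensorComp h b := by
  have hdet : IsUnit (metric φ b).det := (hφ.det_metric_ne_zero b).isUnit
  have hsymm : (tensorComp h b)ᵀ = tensorComp h b := by
    ext i j
    exact hh _ _
  rw [raiseMatrix, metricInv, Matrix.transpose_mul, Matrix.transpose_nonsing_inv,
    (hφ.isSymm_metric b).eq, hsymm, Matrix.nonsing_inv_mul_cancel_right _ _ hdet,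
    Matrix.mul_nonsing_inv_cancel_left _ _ hdet, two_smul]

theorem IsPositive.raiseTwo_eq (hφ : IsPositive φ) (b : Module.Basis (Fin 7) ℝ V) (i j : Fin 7) :
    raiseTwo φ h b i j = (metricInv φ b * tensorComp h b * metricInv φ b) i j := by
  have hsymm : (metricInv φ b)ᵀ = metricInv φ b := by
    rw [metricInv, Matrix.transpose_nonsing_inv, (hφ.isSymm_metric b).eq]
  simp only [raiseTwo, Matrix.mul_apply, Finset.sum_mul]
  rw [Finset.sum_comm]
  refine Finset.sum_congr rfl fun q _ => Finset.sum_congr rfl fun p _ => ?_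
  rw [← congrFun (congrFun hsymm q) j, Matrix.transpose_apply]
  ring

end Flow

end G2

end

theorem mainTheorem5_general {V : Type*} [AddCommGroup V] [Module ℝ V]
    {φ : ℝ → V [⋀^Fin 3]→ₗ[ℝ] ℝ} (b : Module.Basis (Fin 7) ℝ V) (h : LinearMap.BilinForm ℝ V)
    (h_symm : ∀ u v, h u v = h v u) (X : V) {J : Set ℝ} {t : ℝ} (hpos : G2.IsPositive (φ t))
    (hflow : ∀ i j k, HasDerivWithinAt (fun s => φ s ![b i, b j, b k])
      (G2.flowRHS (φ t) h X b i j k) J t) :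
    (∀ i j, HasDerivWithinAt (fun s => G2.tensorB (φ s) b i j)
      (G2.traceG (φ t) h b * G2.tensorB (φ t) b i j
        + ∑ l, G2.raiseOne (φ t) h b l i * G2.tensorB (φ t) b l j
        + ∑ l, G2.raiseOne (φ t) h b l j * G2.tensorB (φ t) b i l) J t) ∧
    (∀ i j, HasDerivWithinAt (fun s => G2.metric (φ s) b i j) (2 * G2.tensorComp h b i j) J t) ∧
    (∀ i j, HasDerivWithinAt (fun s => G2.metricInv (φ s) b i j)
      (-2 * G2.raiseTwo (φ t) h b i j) J t) ∧
    (∀ v, HasDerivWithinAt (fun s => G2.volForm (φ s) b v)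
      (G2.traceG (φ t) h b * G2.volForm (φ t) b v) J t) := by
  have hB := hpos.hasDerivWithinAt_tensorB hflow
  have hB0 := hpos.det_tensorB_ne_zero b
  have hmetric (i j : Fin 7) : HasDerivWithinAt (fun s => G2.metric (φ s) b i j)
      (((2 : ℝ) • G2.tensorComp h b) i j) J t := by
    rw [← hpos.transpose_raiseMatrix_mul_metric_add h_symm b]
    exact G2.hasDerivWithinAt_metric hB hB0 i j
  refine ⟨fun i j => (hB i j).congr_deriv ?_, hmetric, fun i j => ?_, fun v => ?_⟩
  · simp only [G2.trace_raiseMatrix h_symm, Matrix.add_apply, Matrix.smul_apply, smul_eq_mul,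
      Matrix.mul_apply, Matrix.transpose_apply, G2.raiseMatrix_apply, mul_comm]
  · refine (G2.hasDerivWithinAt_inv_apply hmetric (hpos.det_metric_ne_zero b) i j).congr_deriv ?_
    rw [hpos.raiseTwo_eq, Matrix.mul_smul, Matrix.smul_mul, Matrix.smul_apply, smul_eq_mul,
      neg_mul]
    rfl
  · rw [← G2.trace_raiseMatrix h_symm]
    exact G2.hasDerivWithinAt_volForm (G2.hasDerivWithinAt_root9_det_tensorB hB hB0) v

theorem mainTheorem5 {M : Type*} [TopologicalSpace M]
    [ChartedSpace (EuclideanSpace ℝ (Fin 7)) M] [IsManifold (𝓡 7) ∞ M]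
    (J : Set ℝ) (φ : ℝ → G2.G2Structure M)
    (h : ℝ → ∀ x : M, LinearMap.BilinForm ℝ (TangentSpace (𝓡 7) x))
    (h_symm : ∀ t ∈ J, ∀ (x : M) (u v : TangentSpace (𝓡 7) x), h t x u v = h t x v u)
    (X : ℝ → ∀ x : M, TangentSpace (𝓡 7) x)
    (e : OpenPartialHomeomorph M (EuclideanSpace ℝ (Fin 7)))
    (he : e ∈ IsManifold.maximalAtlas (𝓡 7) ∞ M)
    (hflow : G2.IsGeneralFlow he J φ h X)
    (x : M) (hx : x ∈ e.source) (t : ℝ) (ht : t ∈ J) :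
    (∀ i j : Fin 7,
      HasDerivWithinAt (fun s => G2.tensorB ((φ s).at x) (G2.coordFrame he hx) i j)
        (G2.traceG ((φ t).at x) (h t x) (G2.coordFrame he hx)
            * G2.tensorB ((φ t).at x) (G2.coordFrame he hx) i j
          + ∑ l, G2.raiseOne ((φ t).at x) (h t x) (G2.coordFrame he hx) l i
            * G2.tensorB ((φ t).at x) (G2.coordFrame he hx) l j
          + ∑ l, G2.raiseOne ((φ t).at x) (h t x) (G2.coordFrame he hx) l j
            * G2.tensorB ((φ t).at x) (G2.coordFrame he hx) i l) J t) ∧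
    (∀ i j : Fin 7,
      HasDerivWithinAt (fun s => G2.metric ((φ s).at x) (G2.coordFrame he hx) i j)
        (2 * G2.tensorComp (h t x) (G2.coordFrame he hx) i j) J t) ∧
    (∀ i j : Fin 7,
      HasDerivWithinAt (fun s => G2.metricInv ((φ s).at x) (G2.coordFrame he hx) i j)
        (-2 * G2.raiseTwo ((φ t).at x) (h t x) (G2.coordFrame he hx) i j) J t) ∧
    (∀ v : Fin 7 → TangentSpace (𝓡 7) x,
      HasDerivWithinAt (fun s => G2.volForm ((φ s).at x) (G2.coordFrame he hx) v)
        (G2.traceG ((φ t).at x) (h t x) (G2.coordFrame he hx)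
          * G2.volForm ((φ t).at x) (G2.coordFrame he hx) v) J t) :=
  mainTheorem5_general (G2.coordFrame he hx) (h t x) (h_symm t ht x) (X t x) ((φ t).positive x)
    fun i j k => hflow x hx t ht i j k
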